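/- For an integer $n\ge 1$ let $O_n$ be the linear crossed octagonal graph: its vertices are $1,2,\dots,3n+1$ and $1',2',\dots,(3n+1)'$, and its edges are, for each $1\le i\le 3n$, the four edges $\{i,i+1\}$, $\{i',(i+1)'\}$, $\{i,(i+1)'\}$, $\{i',i+1\}$, and, for each $0\le k\le n$, the edge $\{3k+1,(3k+1)'\}$. For vertices $u,v$ of a finite connected graph $G$, the resistance distance $r_G(u,v)$ is the effective resistance between $u$ and $v$ in the electrical network obtained from $G$ by replacing every edge with a unit resistor, i.e. the potential difference $\varphi(u)-\varphi(v)$ when a unit current enters at $u$ and leaves at $v$. The Kirchhoff index is $Kf(G)=\sum_{\{u,v\}} r_G(u,v)$, the sum over all unordered pairs of distinct vertices. Theorem 1.1. For every integer $n\ge 1$, the graph $O_n$ is connected, has $6n+2$ vertices and $13n+1$ edges, and $$Kf(O_n)=\frac{27n^3+51n^2+26n+4}{6}.$$ -/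

import Mathlib

/-- The electrical network on `G` with a unit resistor on every edge, when a unit current enters at
`s` and leaves at `t`: `φ` is a potential of this network if the net current out of each vertex
`x`, by Ohm's law the sum of `φ x - φ y` over the neighbours `y` of `x`, is the current fed in
at `x` (Kirchhoff's current law). -/
def IsUnitCurrentPotential {V : Type*} [Fintype V] [DecidableEq V] (G : SimpleGraph V)
    [DecidableRel G.Adj] (s t : V) (φ : V → ℝ) : Prop :=
  ∀ x : V, ∑ y ∈ G.neighborFinset x, (φ x - φ y) =
    (if x = s then 1 else 0) - (if x = t then 1 else 0)

open Classical in
/-- The resistance distance between `s` and `t`: the potential difference `φ s - φ t` for a unit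
current from `s` to `t`. In a connected graph such a potential exists, and the difference does not
depend on the choice of it (`resistanceDist_eq`). If no such current exists (`s` and `t` in
different components), the value is `0` by convention. -/
noncomputable def resistanceDist {V : Type*} [Fintype V] [DecidableEq V] (G : SimpleGraph V)
    [DecidableRel G.Adj] (s t : V) : ℝ :=
  if h : ∃ φ : V → ℝ, IsUnitCurrentPotential G s t φ then h.choose s - h.choose t else 0

/-- The resistance distance can be computed from any potential. -/
theorem resistanceDist_eq {V : Type*} [Fintype V] [DecidableEq V] (G : SimpleGraph V)
    [DecidableRel G.Adj] (s t : V) (φ : V → ℝ) (hφ : IsUnitCurrentPotential G s t φ) :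
    resistanceDist G s t = φ s - φ t := by
  have key : ∀ f g : V → ℝ, IsUnitCurrentPotential G s t f →
      ∑ x, g x * ∑ y ∈ G.neighborFinset x, (f x - f y) = g s - g t := by
    intro f g hf
    simp only [hf _, mul_sub, Finset.sum_sub_distrib, mul_ite, mul_one, mul_zero,
      Finset.sum_ite_eq', Finset.mem_univ, if_true]
  have symm : ∀ f g : V → ℝ,
      ∑ x, g x * ∑ y ∈ G.neighborFinset x, (f x - f y) =
        ∑ x, f x * ∑ y ∈ G.neighborFinset x, (g x - g y) := by
    intro f g
    simp only [Finset.mul_sum, mul_sub, Finset.sum_sub_distrib]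
    congr 1
    · simp only [mul_comm]
    · simp only [SimpleGraph.neighborFinset_eq_filter, Finset.sum_filter]
      rw [Finset.sum_comm]
      simp only [G.adj_comm, mul_comm]
  have h : ∃ ψ : V → ℝ, IsUnitCurrentPotential G s t ψ := ⟨φ, hφ⟩
  rw [resistanceDist, dif_pos h, ← key φ h.choose hφ, symm, key _ φ h.choose_spec]

/-- The Kirchhoff index: the sum of the resistance distances over all unordered pairs of vertices,
as half of the sum over all ordered pairs (the terms with `s = t` are `0`). -/
noncomputable def kirchhoffIndex {V : Type*} [Fintype V] [DecidableEq V] (G : SimpleGraph V)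
    [DecidableRel G.Adj] : ℝ :=
  (∑ s : V, ∑ t : V, resistanceDist G s t) / 2

/-- The linear crossed octagonal graph `O_n`. The vertex `(i, false)` is the `(i+1)`-st vertex of
the upper path and `(i, true)` the one opposite to it on the lower path, `0 ≤ i ≤ 3n`. Two vertices
in consecutive positions are always adjacent (the edges of the two paths and the crossed pairs),
and the two vertices in the same position `i` are adjacent when `i` is a multiple of `3` (the
vertical edges that bound the `n` octagons). -/
def linearCrossedOctagonal (n : ℕ) : SimpleGraph (Fin (3 * n + 1) × Bool) where
  Adj u v := u.1.val + 1 = v.1.val ∨ v.1.val + 1 = u.1.val ∨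
    (u.1 = v.1 ∧ 3 ∣ u.1.val ∧ u.2 ≠ v.2)
  symm := ⟨fun u v h => by
    rcases h with h | h | ⟨h1, h2, h3⟩
    · exact Or.inr (Or.inl h)
    · exact Or.inl h
    · exact Or.inr (Or.inr ⟨h1.symm, h1 ▸ h2, h3.symm⟩)⟩
  loopless := ⟨fun u h => by
    rcases h with h | h | ⟨_, _, h⟩
    · omega
    · omega
    · exact h rfl⟩

instance (n : ℕ) : DecidableRel (linearCrossedOctagonal n).Adj := fun u v =>
  inferInstanceAs (Decidable (u.1.val + 1 = v.1.val ∨ v.1.val + 1 = u.1.val ∨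
    (u.1 = v.1 ∧ 3 ∣ u.1.val ∧ u.2 ≠ v.2)))

/-! Split functions on the vertices into parts symmetric and antisymmetric under exchange of the two
sides. Consecutive positions are completely joined, so on symmetric functions the Laplacian is twice
that of a path, while on antisymmetric ones the neighbouring positions cancel and it is diagonal.
Both parts are inverted explicitly, giving a potential
(`isUnitCurrentPotential_octagonalPotential`). Each resistance distance is thus `|i - j| / 4` plus
local terms (`resistanceDist_linearCrossedOctagonal`), and the index becomes an elementary double
sum. -/

open Finset

/-- The sum of a function over the neighbours of a vertex of `O_n`: both vertices in the next
position, both in the previous position, and the opposite vertex if there is a vertical edge. -/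
theorem linearCrossedOctagonal_sum_neighborFinset (n : ℕ) (F : ℕ → Bool → ℝ)
    (x : Fin (3 * n + 1) × Bool) :
    ∑ y ∈ (linearCrossedOctagonal n).neighborFinset x, F y.1 y.2 =
      (if x.1.val < 3 * n then F (x.1 + 1) true + F (x.1 + 1) false else 0) +
      (if 0 < x.1.val then F (x.1 - 1) true + F (x.1 - 1) false else 0) +
      (if 3 ∣ x.1.val then F x.1 (!x.2) else 0) := by
  obtain ⟨⟨i, hi⟩, b⟩ := x
  have split : ∀ (k : Fin (3 * n + 1)) (c : Bool),
      (if (linearCrossedOctagonal n).Adj (⟨i, hi⟩, b) (k, c) then F k c else 0) =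
        (if i + 1 = k.val then F k c else 0) + (if k.val + 1 = i then F k c else 0) +
        (if i = k.val then (if 3 ∣ i ∧ b ≠ c then F k c else 0) else 0) := by
    intro k c
    simp only [linearCrossedOctagonal, Fin.ext_iff]
    by_cases h₁ : i + 1 = k.val
    · have h₂ : ¬ k.val + 1 = i := by omega
      have h₃ : ¬ i = k.val := by omega
      simp [h₁, h₂, h₃]
    · by_cases h₂ : k.val + 1 = i
      · have h₃ : ¬ i = k.val := by omega
        simp [h₁, h₂, h₃]
      · by_cases h₃ : i = k.val <;> simp [h₁, h₂, h₃]
  have column : ∀ c : Bool,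
      ∑ k : Fin (3 * n + 1),
        (if (linearCrossedOctagonal n).Adj (⟨i, hi⟩, b) (k, c) then F k c else 0) =
      (if i < 3 * n then F (i + 1) c else 0) + (if 0 < i then F (i - 1) c else 0) +
        (if 3 ∣ i ∧ b ≠ c then F i c else 0) := by
    intro c
    simp only [split, sum_add_distrib]
    rw [Fin.sum_univ_eq_sum_range (fun k => if i + 1 = k then F k c else 0),
      Fin.sum_univ_eq_sum_range (fun k => if k + 1 = i then F k c else 0),
      Fin.sum_univ_eq_sum_range
        (fun k => if i = k then (if 3 ∣ i ∧ b ≠ c then F k c else 0) else 0)]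
    congr 1
    · congr 1
      · simp [sum_ite_eq]
      · rcases i with _ | i
        · simp
        · have : i < 3 * n + 1 := by omega
          simp [this]
    · simp [sum_ite_eq, hi]
  rw [SimpleGraph.neighborFinset_eq_filter, sum_filter, Fintype.sum_prod_type_right,
    Fintype.sum_bool, column, column]
  cases b <;> by_cases h₃ : 3 ∣ i <;> simp [h₃] <;> split_ifs <;> ring

/-! ### Potentials and resistance distances -/

/-- The sign of a side of the ladder. -/
def sideSign (b : Bool) : ℝ := if b then 1 else -1

/-- The inverse of the eigenvalue of the Laplacian of `O_n` on the antisymmetric function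
supported on the two vertices in position `i`. -/
noncomputable def rungResistance (n i : ℕ) : ℝ :=
  1 / 4 - (if 3 ∣ i then 1 / 12 else 0) + (if i = 0 then 1 / 12 else 0) +
    (if i = 3 * n then 1 / 12 else 0)

/-- The eigenvalue is the degree, plus one more if there is a vertical edge, across which the sign
flips: `4` at the ends, `6` or `4` inside. `1 ≤ n` keeps the two ends distinct; for `n = 0` the
eigenvalue would be `2`. -/
theorem rungResistance_mul {n : ℕ} (hn : 1 ≤ n) {i : ℕ} (hi : i < 3 * n + 1) :
    ((if i < 3 * n then 2 else 0) + (if 0 < i then 2 else 0) + (if 3 ∣ i then 2 else 0)) *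
      rungResistance n i = 1 := by
  unfold rungResistance
  rcases Nat.eq_zero_or_pos i with rfl | h₀
  · have h₁ : 0 < 3 * n := by omega
    have h₂ : ¬ 0 = 3 * n := by omega
    rw [if_pos h₁, if_neg h₂]
    norm_num
  · rcases (Nat.lt_succ_iff.mp hi).lt_or_eq with h | rfl
    · rw [if_pos h, if_pos h₀, if_neg h₀.ne', if_neg h.ne]
      split_ifs <;> norm_num
    · rw [if_neg (lt_irrefl _), if_pos h₀, if_neg h₀.ne', if_pos rfl, if_pos (dvd_mul_right 3 n)]
      norm_num

/-- The Laplacian of the path on `0, …, N`, applied to a difference of two distance functions. -/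
theorem path_laplacian_dist_sub_dist {N i j x : ℕ} (hi : i ≤ N) (hj : j ≤ N) (hx : x ≤ N)
    (p : ℕ → ℝ) (hp : ∀ k : ℕ, p k = |(k : ℝ) - j| - |(k : ℝ) - i|) :
    (if x < N then p x - p (x + 1) else 0) + (if 0 < x then p x - p (x - 1) else 0) =
      2 * ((if x = i then 1 else 0) - (if x = j then 1 else 0)) := by
  have right : ∀ a : ℕ, |(x : ℝ) + 1 - a| - |(x : ℝ) - a| = if a ≤ x then 1 else -1 := by
    intro a
    split_ifs with h
    · have : (a : ℝ) ≤ x := by exact_mod_cast h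
      rw [abs_of_nonneg (by linarith), abs_of_nonneg (by linarith)]; ring
    · have : (x : ℝ) + 1 ≤ a := by exact_mod_cast not_le.mp h
      rw [abs_of_nonpos (by linarith), abs_of_nonpos (by linarith)]; ring
  have left : ∀ a : ℕ, |(x : ℝ) - 1 - a| - |(x : ℝ) - a| = if x ≤ a then 1 else -1 := by
    intro a
    split_ifs with h
    · have : (x : ℝ) ≤ a := by exact_mod_cast h
      rw [abs_of_nonpos (by linarith), abs_of_nonpos (by linarith)]; ring
    · have : (a : ℝ) + 1 ≤ x := by exact_mod_cast not_le.mp h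
      rw [abs_of_nonneg (by linarith), abs_of_nonneg (by linarith)]; ring
  have hright : p x - p (x + 1) = (if i ≤ x then 1 else -1) - (if j ≤ x then 1 else -1) := by
    rw [← right, ← right, hp, hp]; push_cast; ring
  have hleft : 0 < x →
      p x - p (x - 1) = (if x ≤ i then 1 else -1) - (if x ≤ j then 1 else -1) := by
    intro h
    rw [← left, ← left, hp, hp, Nat.cast_sub h]; push_cast; ring
  have total : ∀ a : ℕ, ((if a ≤ x then 1 else -1) + (if x ≤ a then 1 else -1) : ℝ) =
      2 * (if x = a then 1 else 0) := by
    intro a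
    rcases lt_trichotomy x a with h | rfl | h
    · simp [h.le, h.ne, not_le.mpr h]
    · norm_num
    · simp [h.le, h.ne', not_le.mpr h]
  rw [hright, mul_sub, ← total, ← total]
  -- Beyond an end of the path both distance functions have the same slope, so the missing neighbour
  -- would contribute `0` anyway.
  have e₁ : ¬ x < N → ((if i ≤ x then 1 else -1) - (if j ≤ x then 1 else -1) : ℝ) = 0 := by
    intro h
    rw [if_pos (by omega), if_pos (by omega), sub_self]
  have e₂ : ¬ 0 < x → ((if x ≤ i then 1 else -1) - (if x ≤ j then 1 else -1) : ℝ) = 0 := by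
    intro h
    rw [if_pos (by omega), if_pos (by omega), sub_self]
  by_cases h₁ : x < N <;> by_cases h₂ : 0 < x
  · rw [if_pos h₁, if_pos h₂, hleft h₂]; ring
  · rw [if_pos h₁, if_neg h₂]; linarith [e₂ h₂]
  · rw [if_neg h₁, if_pos h₂, hleft h₂]; linarith [e₁ h₁]
  · rw [if_neg h₁, if_neg h₂]; linarith [e₁ h₁, e₂ h₂]

/-- A potential of the unit current in `O_n` from `(i, b)` to `(j, c)`. -/
noncomputable def octagonalPotential (n i j : ℕ) (b c : Bool) (x : ℕ) (d : Bool) : ℝ :=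
  (|(x : ℝ) - j| - |(x : ℝ) - i|) / 8 +
    sideSign d * (rungResistance n x *
      ((if x = i then sideSign b else 0) - (if x = j then sideSign c else 0)) / 2)

theorem isUnitCurrentPotential_octagonalPotential {n : ℕ} (hn : 1 ≤ n)
    (s t : Fin (3 * n + 1) × Bool) :
    IsUnitCurrentPotential (linearCrossedOctagonal n) s t
      (fun x => octagonalPotential n s.1 t.1 s.2 t.2 x.1 x.2) := by
  obtain ⟨⟨i, hi⟩, b⟩ := s
  obtain ⟨⟨j, hj⟩, c⟩ := t
  rintro ⟨⟨x, hx⟩, d⟩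
  have key := linearCrossedOctagonal_sum_neighborFinset n
    (fun y e => octagonalPotential n i j b c x d - octagonalPotential n i j b c y e)
    (⟨x, hx⟩, d)
  refine key.trans ?_
  have hpath := path_laplacian_dist_sub_dist (Nat.lt_succ_iff.mp hi) (Nat.lt_succ_iff.mp hj)
    (Nat.lt_succ_iff.mp hx) (fun k => |(k : ℝ) - j| - |(k : ℝ) - i|) (fun _ => rfl)
  have hrung := rungResistance_mul hn hx
  -- A point source is half a symmetric source plus half an antisymmetric one.
  have source : ∀ (a : ℕ) (ha : a < 3 * n + 1) (e : Bool),
      (if ((⟨x, hx⟩, d) : Fin (3 * n + 1) × Bool) = (⟨a, ha⟩, e) then 1 else 0 : ℝ) =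
        ((if x = a then 1 else 0) + sideSign d * (if x = a then sideSign e else 0)) / 2 := by
    intro a ha e
    by_cases h : x = a
    · cases d <;> cases e <;> norm_num [h, sideSign]
    · simp [h]
  rw [source, source]
  simp only [octagonalPotential] at hpath ⊢
  have hflip : sideSign (!d) = - sideSign d := by cases d <;> simp [sideSign]
  have ht : sideSign true = 1 := rfl
  have hf : sideSign false = -1 := by simp [sideSign]
  rw [hflip, ht, hf]
  have hsum := congrArg (fun r => sideSign d *
    ((if x = i then sideSign b else 0) - (if x = j then sideSign c else 0)) / 2 * r) hrung
  -- The factor `1 / 4`: two neighbours per adjacent position, times the `1 / 8` in the potential.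
  -- `hsum` settles the antisymmetric part.
  by_cases h₁ : x < 3 * n <;> by_cases h₂ : 0 < x <;> by_cases h₃ : 3 ∣ x <;>
    simp only [h₁, h₂, h₃, if_true, if_false] at hpath hsum ⊢ <;>
    linear_combination hpath / 4 + hsum

theorem resistanceDist_linearCrossedOctagonal {n : ℕ} (hn : 1 ≤ n)
    (s t : Fin (3 * n + 1) × Bool) :
    resistanceDist (linearCrossedOctagonal n) s t =
      |(s.1.val : ℝ) - t.1.val| / 4 +
        (1 - if s.1 = t.1 then sideSign s.2 * sideSign t.2 else 0) *
          (rungResistance n s.1 + rungResistance n t.1) / 2 := by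
  rw [resistanceDist_eq _ _ _ _ (isUnitCurrentPotential_octagonalPotential hn s t)]
  obtain ⟨⟨i, hi⟩, b⟩ := s
  obtain ⟨⟨j, hj⟩, c⟩ := t
  simp only [octagonalPotential, Fin.mk.injEq]
  have sq : ∀ e, sideSign e * sideSign e = 1 := by intro e; cases e <;> norm_num [sideSign]
  by_cases h : i = j
  · subst h
    simp only [if_true, sub_self, abs_zero]
    linear_combination (rungResistance n i / 2) * (sq b + sq c)
  · simp only [h, Ne.symm h, if_true, if_false, sub_self, abs_zero, abs_sub_comm (j : ℝ) i]
    linear_combination (rungResistance n i / 2) * sq b + (rungResistance n j / 2) * sq c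

/-! ### Summation over all pairs -/

theorem sum_range_ite_three_dvd (n : ℕ) (a : ℝ) :
    ∑ i ∈ range (3 * n + 1), (if 3 ∣ i then a else 0) = (n + 1) * a := by
  induction n with
  | zero => simp
  | succ n ih =>
    rw [show 3 * (n + 1) + 1 = 3 * n + 1 + 1 + 1 + 1 by ring, sum_range_succ, sum_range_succ,
      sum_range_succ, ih, if_neg (by omega), if_neg (by omega), if_pos (by omega)]
    push_cast; ring

theorem sum_rungResistance (n : ℕ) :
    ∑ i ∈ range (3 * n + 1), rungResistance n i = (2 * n + 1) / 3 := by
  simp only [rungResistance, sum_add_distrib, sum_sub_distrib, sum_range_ite_three_dvd,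
    sum_ite_eq', sum_const, card_range, nsmul_eq_mul, mem_range]
  rw [if_pos (by omega), if_pos (by omega)]
  push_cast; ring

theorem sum_range_abs_sub_self (m : ℕ) :
    ∑ i ∈ range m, |(i : ℝ) - m| = m * (m + 1) / 2 := by
  have h : ∀ i ∈ range m, |(i : ℝ) - m| = m - i := by
    intro i hi
    have : (i : ℝ) ≤ m := by exact_mod_cast (mem_range.mp hi).le
    rw [abs_of_nonpos (by linarith)]; ring
  have gauss : ∀ k : ℕ, ∑ i ∈ range k, (i : ℝ) = k * (k - 1) / 2 := by
    intro k
    induction k with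
    | zero => simp
    | succ k ih => rw [sum_range_succ, ih]; push_cast; ring
  rw [sum_congr rfl h, sum_sub_distrib, gauss, sum_const, card_range, nsmul_eq_mul]
  ring

theorem sum_range_sum_range_abs_sub (m : ℕ) :
    ∑ i ∈ range m, ∑ j ∈ range m, |(i : ℝ) - j| = m * (m ^ 2 - 1) / 3 := by
  induction m with
  | zero => simp
  | succ m ih =>
    simp only [sum_range_succ, sum_add_distrib, ih, sum_range_abs_sub_self, sub_self, abs_zero,
      abs_sub_comm (m : ℝ)]
    push_cast; ring

theorem kirchhoffIndex_linearCrossedOctagonal {n : ℕ} (hn : 1 ≤ n) :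
    kirchhoffIndex (linearCrossedOctagonal n) =
      (27 * (n : ℝ) ^ 3 + 51 * (n : ℝ) ^ 2 + 26 * (n : ℝ) + 4) / 6 := by
  have hsum : ∑ s, ∑ t, resistanceDist (linearCrossedOctagonal n) s t =
      ∑ i ∈ range (3 * n + 1), ∑ j ∈ range (3 * n + 1),
        (|(i : ℝ) - j| + 2 * (rungResistance n i + rungResistance n j)) := by
    rw [← Fin.sum_univ_eq_sum_range (fun i => ∑ j ∈ range (3 * n + 1),
        (|(i : ℝ) - j| + 2 * (rungResistance n i + rungResistance n j))), Fintype.sum_prod_type]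
    refine sum_congr rfl fun i _ => ?_
    rw [← Fin.sum_univ_eq_sum_range
      (fun j => |(i.val : ℝ) - j| + 2 * (rungResistance n i + rungResistance n j)),
      Fintype.sum_bool, Fintype.sum_prod_type, Fintype.sum_prod_type, ← sum_add_distrib]
    refine sum_congr rfl fun j _ => ?_
    simp only [Fintype.sum_bool, resistanceDist_linearCrossedOctagonal hn]
    -- For `i = j` only the two ordered pairs of opposite vertices contribute, each `2 *
    -- rungResistance n i`; the total agrees with the formula for `i ≠ j`.
    by_cases h : i = j <;>
      simp only [h, sideSign, if_true, if_false, Bool.false_eq_true] <;> ring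
  rw [kirchhoffIndex, hsum]
  simp only [sum_add_distrib, ← mul_sum, sum_range_sum_range_abs_sub, sum_rungResistance,
    sum_const, card_range, nsmul_eq_mul]
  push_cast; ring

/-! ### Edge count and connectedness -/

theorem card_edgeFinset_linearCrossedOctagonal (n : ℕ) :
    (linearCrossedOctagonal n).edgeFinset.card = 13 * n + 1 := by
  have hdeg : ∀ x : Fin (3 * n + 1) × Bool, ((linearCrossedOctagonal n).degree x : ℝ) =
      (if x.1.val < 3 * n then 2 else 0) + (if 0 < x.1.val then 2 else 0) +
        (if 3 ∣ x.1.val then 1 else 0) := by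
    intro x
    have h := linearCrossedOctagonal_sum_neighborFinset n (fun _ _ => 1) x
    rw [sum_const, nsmul_eq_mul, mul_one, SimpleGraph.card_neighborFinset_eq_degree] at h
    rw [h]; norm_num
  have hright : ∑ i ∈ range (3 * n + 1), (if i < 3 * n then 2 else 0 : ℝ) = 6 * n := by
    rw [sum_range_succ, if_neg (lt_irrefl _),
      sum_congr rfl fun i hi => if_pos (mem_range.mp hi), sum_const, card_range, nsmul_eq_mul]
    push_cast; ring
  have hleft : ∑ i ∈ range (3 * n + 1), (if 0 < i then 2 else 0 : ℝ) = 6 * n := by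
    rw [sum_range_succ', if_neg (lt_irrefl _),
      sum_congr rfl fun i _ => if_pos (Nat.succ_pos i), sum_const, card_range, nsmul_eq_mul]
    push_cast; ring
  have h : ((2 * (linearCrossedOctagonal n).edgeFinset.card : ℕ) : ℝ) = 2 * (13 * n + 1) := by
    rw [← SimpleGraph.sum_degrees_eq_twice_card_edges, Nat.cast_sum]
    simp only [hdeg]
    rw [Fintype.sum_prod_type_right, Fintype.sum_bool, Fin.sum_univ_eq_sum_range
      (fun i => (if i < 3 * n then 2 else 0) + (if 0 < i then 2 else 0) +
        (if 3 ∣ i then 1 else 0) : ℕ → ℝ), sum_add_distrib, sum_add_distrib, hright, hleft,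
      sum_range_ite_three_dvd]
    ring
  have h' : 2 * (linearCrossedOctagonal n).edgeFinset.card = 2 * (13 * n + 1) := by
    exact_mod_cast h
  omega

/-- Both vertices of a position are joined to the upper vertex of the previous one, so only position
`0` needs its vertical edge. -/
theorem connected_linearCrossedOctagonal (n : ℕ) : (linearCrossedOctagonal n).Connected := by
  have base : ∀ (i : ℕ) (hi : i < 3 * n + 1) (b : Bool),
      (linearCrossedOctagonal n).Reachable (⟨i, hi⟩, b) (⟨0, by omega⟩, false) := by
    intro i
    induction i with
    | zero =>
      intro hi b
      cases b
      · exact SimpleGraph.Reachable.refl _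
      · exact SimpleGraph.Adj.reachable (Or.inr (Or.inr ⟨rfl, dvd_zero 3, Bool.noConfusion⟩))
    | succ i ih =>
      intro hi b
      have step : (linearCrossedOctagonal n).Adj (⟨i + 1, hi⟩, b) (⟨i, by omega⟩, false) :=
        Or.inr (Or.inl rfl)
      exact step.reachable.trans (ih _ _)
  exact (SimpleGraph.connected_iff_exists_forall_reachable _).mpr
    ⟨(⟨0, by omega⟩, false), fun x => (base x.1 x.1.2 x.2).symm⟩

theorem theorem1p1 (n : ℕ) (hn : 1 ≤ n) :
    Fintype.card (Fin (3 * n + 1) × Bool) = 6 * n + 2 ∧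
    (linearCrossedOctagonal n).edgeFinset.card = 13 * n + 1 ∧
    (linearCrossedOctagonal n).Connected ∧
    kirchhoffIndex (linearCrossedOctagonal n) =
      (27 * (n : ℝ) ^ 3 + 51 * (n : ℝ) ^ 2 + 26 * (n : ℝ) + 4) / 6 := by
  refine ⟨?_, card_edgeFinset_linearCrossedOctagonal n, connected_linearCrossedOctagonal n,
    kirchhoffIndex_linearCrossedOctagonal hn⟩
  rw [Fintype.card_prod, Fintype.card_fin, Fintype.card_bool]
  ring
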